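/- Let $\alpha\in(0,\tfrac12)$ be irrational with continued fraction expansion $\alpha=[0;a_1,a_2,\ldots]$ (so $a_1\ge 2$), let $q_0=1$, $q_1=a_1$, $q_k=a_kq_{k-1}+q_{k-2}$ for $k\ge 2$ be the denominators of its convergents, and put $q_{k,l}=l\,q_{k-1}+q_{k-2}$ for $k\ge 2$ and $0\le l\le a_k$. Write $\{x\}$ for the fractional part of $x$ and $\|x\|=\min\{\{x\},1-\{x\}\}$. Define words over $\{0,1\}$ by $s_0=0$, $s_1=0^{a_1-1}1$, $s_k=s_{k-1}^{a_k}s_{k-2}$ for $k\ge2$, and $s_{k,l}=s_{k-1}^{l}s_{k-2}$ for $k\ge 2$, $0<l\le a_k$ (so $s_{k,a_k}=s_k$). Let $\widetilde w$ denote the reversal of a word $w$, and let $C$ be the cyclic shift $C(b_1\cdots b_{m-1}b_m)=b_mb_1\cdots b_{m-1}$. Divide the circle $[0,1)$ by the points $0$ and $1-\alpha$ into two half-open intervals, either $I_0=[0,1-\alpha)$, $I_1=[1-\alpha,1)$, or $I_0=(0,1-\alpha]$, $I_1=(1-\alpha,1]$ (where $1$ is identified with $0$). For a point $x$ of the circle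 let $s_{x,\alpha}$ be the Sturmian word of slope $\alpha$ whose $n$th letter ($n\ge 0$) is $0$ or $1$ according as $\{x+n\alpha\}$ lies in $I_0$ or $I_1$. By a factor we mean a factor of $s_{\rho,\alpha}$, where the choice of $I_0,I_1$ and the point $\rho$ are arbitrary. For a factor $w$ let $[w]$ be the interval of all points $x$ such that $s_{x,\alpha}$ begins with $w$, and $|[w]|$ its length. **Theorem.** Let $n=q_{k,l}$ with $k\ge 2$ and $0<l\le a_k$. Then the $n$ conjugates $C^i(\widetilde s_{k,l})$, $0\le i\le n-1$, are distinct factors of length $n$, and there is exactly one further factor $v$ of length $n$. Moreover: - $|[C^i(\widetilde s_{k,l})]|=\|q_{k,l-1}\alpha\|$ for $0\le i<q_{k-1}-1$ (the first $q_{k-1}-1$ conjugates); - $|[C^i(\widetilde s_{k,l})]|=\|q_{k-1}\alpha\|$ for $q_{k-1}-1\le i\le n-1$ (the other $n+1-q_{k-1}$ conjugates); - $|[v]|=\|q_{k,l}\alpha\|$. -/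

import Mathlib

namespace Sturmian

/-! ### Continued fractions -/

/-- The partial quotients of the continued fraction expansion `[a₀; a₁, a₂, …]` of `α ≥ 0`, read off
from Mathlib's regular continued fraction of `α`. -/
noncomputable def partialQuotient (α : ℝ) : ℕ → ℕ
  | 0 => ⌊(GenContFract.of α).h⌋₊
  | k + 1 => ((GenContFract.of α).partDens.get? k).elim 0 (fun b => ⌊b⌋₊)

/-- For irrational `α` the expansion is infinite and no information is lost in `partialQuotient`. -/
theorem partDens_get?_eq {α : ℝ} (hα : Irrational α) (k : ℕ) :
    (GenContFract.of α).partDens.get? k = some (partialQuotient α (k + 1) : ℝ) := by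
  have hterm : ¬ (GenContFract.of α).TerminatedAt k := by
    intro h
    obtain ⟨q, hq⟩ := (GenContFract.terminates_iff_rat α).1 ⟨k, h⟩
    exact hα ⟨q, hq.symm⟩
  rw [GenContFract.terminatedAt_iff_partDen_none] at hterm
  obtain ⟨b, hb⟩ := Option.ne_none_iff_exists'.1 hterm
  obtain ⟨z, hz⟩ := GenContFract.exists_int_eq_of_partDen hb
  have h1 := GenContFract.of_one_le_get?_partDen hb
  have hz0 : (0 : ℤ) ≤ z := by
    have : (0 : ℝ) ≤ (z : ℝ) := by linarith
    exact_mod_cast this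
  obtain ⟨m, rfl⟩ := Int.eq_ofNat_of_zero_le hz0
  simp [partialQuotient, hb, hz]

/-- The denominators `q_k` of the convergents: `q₀ = 1`, `q₁ = a₁`, `q_k = a_k q_{k-1} + q_{k-2}`. -/
noncomputable def convDen (α : ℝ) : ℕ → ℕ
  | 0 => 1
  | 1 => partialQuotient α 1
  | k + 2 => partialQuotient α (k + 2) * convDen α (k + 1) + convDen α k

/-- `q_{k,l} = l q_{k-1} + q_{k-2}`, used only for `k ≥ 2`. -/
noncomputable def semiconvDen (α : ℝ) (k l : ℕ) : ℕ :=
  l * convDen α (k - 1) + convDen α (k - 2)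

/-- `‖x‖ = min {{x}, 1 - {x}}`, the distance from `x` to the nearest integer. -/
noncomputable def circleNorm (x : ℝ) : ℝ :=
  min (Int.fract x) (1 - Int.fract x)

/-! ### Words -/

/-- Finite words over the alphabet `{0, 1}`. -/
abbrev Word := List (Fin 2)

/-- The power `w ^ m = w w ⋯ w` (`m` times). -/
def wordPow (w : Word) (m : ℕ) : Word :=
  (List.replicate m w).flatten

/-- The cyclic shift `C(a₁ ⋯ a_{n-1} a_n) = a_n a₁ ⋯ a_{n-1}`. -/
def cyclicShift : Word → Word
  | [] => []
  | a :: w => (a :: w).getLast (List.cons_ne_nil a w) :: (a :: w).dropLast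

/-- The standard words: `s₀ = 0`, `s₁ = 0 ^ (a₁ - 1) 1`, `s_k = s_{k-1} ^ a_k s_{k-2}`. -/
noncomputable def standardWord (α : ℝ) : ℕ → Word
  | 0 => [0]
  | 1 => wordPow [0] (partialQuotient α 1 - 1) ++ [1]
  | k + 2 => wordPow (standardWord α (k + 1)) (partialQuotient α (k + 2)) ++ standardWord α k

/-- `s_{k,l} = s_{k-1} ^ l s_{k-2}`, used only for `k ≥ 2`; it is `s_k` for `l = a_k`. -/
noncomputable def semistandardWord (α : ℝ) (k l : ℕ) : Word :=
  wordPow (standardWord α (k - 1)) l ++ standardWord α (k - 2)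

/-- The finite word `w` occurs in the infinite word `u` at position `m`. -/
def OccursAt (w : Word) (u : ℕ → Fin 2) (m : ℕ) : Prop :=
  ∀ (i : ℕ) (hi : i < w.length), w[i] = u (m + i)

/-- The language (set of factors) of an infinite word. -/
def language (u : ℕ → Fin 2) : Set Word :=
  {w | ∃ m, OccursAt w u m}

/-! ### Codings of rotations -/

/-- The two ways to treat the endpoints `0` and `1 - α` of the coding intervals. -/
inductive Endpoints
  /-- `I₀ = [0, 1 - α)` and `I₁ = [1 - α, 1)` -/
  | leftClosed
  /-- `I₀ = (0, 1 - α]` and `I₁ = (1 - α, 1]`, where the point `1` of the circle is the point `0` -/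
  | rightClosed

/-- The coding function `ν`, as a function of period `1` on the real line. -/
noncomputable def coding (α : ℝ) : Endpoints → ℝ → Fin 2
  | .leftClosed, x => if 1 - α ≤ Int.fract x then 1 else 0
  | .rightClosed, x => if 1 - α < Int.fract x ∨ Int.fract x = 0 then 1 else 0

/-- The Sturmian word `s_{x,α}`: its `n`-th letter is `ν(Rⁿ(x))`, where `R` is the rotation by `α`. -/
noncomputable def sturmianWord (α : ℝ) (c : Endpoints) (x : ℝ) : ℕ → Fin 2 :=
  fun n => coding α c (x + n * α)

/-- The interval `[w]`: the points `x` of the circle, identified with `[0, 1)`, such that `s_{x,α}`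
begins with `w`. -/
def wordInterval (α : ℝ) (c : Endpoints) (w : Word) : Set ℝ :=
  {x | x ∈ Set.Ico (0 : ℝ) 1 ∧ OccursAt w (sturmianWord α c x) 0}

/-- The length `|[w]|` of the interval `[w]`, as its Lebesgue measure. -/
noncomputable def intervalLength (α : ℝ) (c : Endpoints) (w : Word) : ℝ :=
  (MeasureTheory.volume (wordInterval α c w)).toReal

end Sturmian

/-! The letter of the coding at `x` is `F (x + α) - F x` with `F` the floor or the ceiling, so a
word of length `n` records how often `F` jumps along `x, x + α, …, x + nα`. Words are therefore
constant on the `n + 1` arcs cut out by the points `-rα`, `0 ≤ r ≤ n`. Let `p/n < α < p'/q` be Farey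
neighbours with `q < n`. The point next to `-rα` on its left is the one with index `n` if `r = 0`,
`r + n - q` if `0 < r < q`, and `r - q` if `r ≥ q`; this gives the three lengths in `gap`.

On the arc ending at `-rα` the increments of `F` are those of `⌈mp/n⌉` with `m` counted from time
`r`. The single exception is `m = n`, `r = 0`, where `nα > p` forces `p + 1`. Hence the words with
`1 ≤ r ≤ n` are the cyclic shifts of one periodic word of slope `p/n`, and `r = 0` gives the extra
factor `v`.

Continued fractions supply the pair with `n = q_{k,l}` and `q = q_{k-1}`, for `α` or `-α` according
to the parity of `k` (`semiconv_brackets`). The standard words are prefixes of the characteristic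
word, and reversing `s_{k,l}` gives the word with `r = 1` (`spells_conjugate`). `Brackets.cover`,
`Brackets.disjoint` and `IsStep.volume_jump` show that the arcs partition the circle and have the
stated lengths; density of orbits makes every arc occur for each `ρ`. -/

namespace Sturmian

/-! ### Degree one step functions and a bracketing Farey pair -/

/-- Integer valued monotone functions on the line that commute with the translation by `1`. -/
structure IsStep (F : ℝ → ℤ) : Prop where
  mono : Monotone F
  add_one : ∀ x, F (x + 1) = F x + 1

namespace IsStep

variable {F : ℝ → ℤ}

theorem floor : IsStep (fun x => ⌊x⌋) := ⟨Int.floor_mono, fun x => Int.floor_add_one x⟩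

theorem ceil : IsStep (fun x => ⌈x⌉) := ⟨Int.ceil_mono, fun x => Int.ceil_add_one x⟩

theorem neg (hF : IsStep F) : IsStep (fun x => -F (-x)) where
  mono x y h := neg_le_neg (hF.mono (neg_le_neg h))
  add_one x := by
    have h := hF.add_one (-(x + 1))
    have h2 : -(x + 1) + 1 = -x := by ring
    rw [h2] at h
    show -F (-(x + 1)) = -F (-x) + 1
    omega

theorem add_int (hF : IsStep F) (x : ℝ) (a : ℤ) : F (x + a) = F x + a := by
  induction a using Int.induction_on with
  | zero => simp
  | succ i ih =>
    have h := hF.add_one (x + (i : ℤ))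
    push_cast at *
    rw [← add_assoc, h, ih]; ring
  | pred i ih =>
    have h := hF.add_one (x + ((-(i : ℤ) - 1 : ℤ) : ℝ))
    have h2 : x + ((-(i : ℤ) - 1 : ℤ) : ℝ) + 1 = x + ((-(i : ℤ) : ℤ) : ℝ) := by push_cast; ring
    rw [h2, ih] at h
    omega

theorem sub_int (hF : IsStep F) (x : ℝ) (a : ℤ) : F (x - a) = F x - a := by
  have := hF.add_int x (-a)
  push_cast at this
  rw [sub_eq_add_neg, this]; ring

theorem le_add_one (hF : IsStep F) {x y : ℝ} (h : y ≤ x + 1) : F y ≤ F x + 1 :=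
  hF.add_one x ▸ hF.mono h

end IsStep

/-- The fractions `p / n < α < p' / q` are neighbours, and `0 < q < n`. -/
structure Brackets (α : ℝ) (n p q p' : ℤ) : Prop where
  det : p' * n - p * q = 1
  lower : 0 < n * α - p
  upper : 0 < p' - q * α
  q_pos : 0 < q
  q_lt : q < n

/-- The length of the interval which has `-r α` as an endpoint. -/
noncomputable def gap (α : ℝ) (n p q p' r : ℤ) : ℝ :=
  if r = 0 then n * α - p else if r < q then (n - q) * α - (p - p') else p' - q * α

/-- The increment of the step function along `m` rotations, from the base point `r`. -/
def height (n p r m : ℤ) : ℤ :=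
  if r = 0 ∧ m = n then p + 1 else -((-(m * p)) / n)

namespace Brackets

variable {α : ℝ} {n p q p' : ℤ}

theorem n_pos (h : Brackets α n p q p') : 0 < n := h.q_pos.trans h.q_lt

theorem sum_eq_one (h : Brackets α n p q p') : n * (p' - q * α) + q * (n * α - p) = 1 := by
  have h1 : ((p' * n - p * q : ℤ) : ℝ) = 1 := by rw [h.det]; simp
  push_cast at h1
  linarith

/-- The determinant condition makes `(n, p)` and `(q, p')` a basis of `ℤ²`. The bounds below on `mα
- a` come from the signs of the coordinates `u`, `v` in this basis, with `coord_int` relating them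
to the size of `m`. -/
theorem coord (h : Brackets α n p q p') (m a : ℤ) :
    m * α - a = ((p' * m - q * a : ℤ) : ℝ) * (n * α - p) -
      ((n * a - p * m : ℤ) : ℝ) * (p' - q * α) := by
  have h1 : ((p' * n - p * q : ℤ) : ℝ) = 1 := by rw [h.det]; simp
  push_cast at *
  linear_combination (-(m * α - a)) * h1

theorem coord_int (h : Brackets α n p q p') (m a : ℤ) :
    m = (p' * m - q * a) * n + (n * a - p * m) * q := by
  linear_combination (-m) * h.det

theorem lower_add_upper_le (h : Brackets α n p q p') : (n * α - p) + (p' - q * α) ≤ 1 := by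
  have h1 := h.sum_eq_one
  have hn : (1 : ℝ) ≤ n := by exact_mod_cast h.n_pos
  have hq : (1 : ℝ) ≤ q := by exact_mod_cast h.q_pos
  nlinarith [h.lower, h.upper]

theorem gap_pos (h : Brackets α n p q p') (r : ℤ) : 0 < gap α n p q p' r := by
  have h1 := h.lower
  have h2 := h.upper
  unfold gap
  split_ifs <;> linarith

theorem gap_le (h : Brackets α n p q p') (r : ℤ) :
    gap α n p q p' r ≤ (n * α - p) + (p' - q * α) := by
  have h1 := h.lower
  have h2 := h.upper
  unfold gap
  split_ifs <;> linarith

theorem gap_le_one (h : Brackets α n p q p') (r : ℤ) : gap α n p q p' r ≤ 1 :=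
  (h.gap_le r).trans h.lower_add_upper_le

/-- With `v ≥ 0`, a coordinate `u ≥ 1` would give `m = un + vq ≥ n`. -/
theorem le_ceil (h : Brackets α n p q p') {m : ℤ} (hm : m < n) {a : ℤ} (ha : 0 ≤ n * a - p * m) :
    m * α ≤ a := by
  have hc := h.coord m a
  have hi := h.coord_int m a
  set u := p' * m - q * a
  set v := n * a - p * m
  have hu : u ≤ 0 := by
    by_contra hu
    have := h.n_pos
    have := h.q_pos
    nlinarith
  have hu' : (u : ℝ) ≤ 0 := by exact_mod_cast hu
  have hv' : (0 : ℝ) ≤ v := by exact_mod_cast ha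
  nlinarith [h.lower, h.upper]

/-- For `a - 1` the coordinate `v` is at most `-1`. Then `u < 0` would give `m ≤ -n - q`, and `u =
0` gives `m ≤ -q`. -/
theorem gap_bound (h : Brackets α n p q p') {m a : ℤ} (hm : -n ≤ m)
    (ha : n * a - p * m < n) :
    (p' - q * α ≤ m * α - a + 1) ∧
      (-q < m → (n * α - p) + (p' - q * α) ≤ m * α - a + 1) := by
  have hc := h.coord m (a - 1)
  have hi := h.coord_int m (a - 1)
  have hn := h.n_pos
  have hq := h.q_pos
  set u := p' * m - q * (a - 1)
  have hv0 : n * (a - 1) - p * m ≤ -1 := by nlinarith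
  set v := n * (a - 1) - p * m
  have hv' : (v : ℝ) ≤ -1 := by exact_mod_cast hv0
  have hu : 0 ≤ u := by
    by_contra hu
    have h1 : u * n ≤ -1 * n := by nlinarith
    have h2 : v * q ≤ -1 * q := by nlinarith
    omega
  have hu' : (0 : ℝ) ≤ u := by exact_mod_cast hu
  have hl := h.lower
  have hup := h.upper
  push_cast at hc
  refine ⟨by nlinarith, fun hmq => ?_⟩
  have hu1 : 1 ≤ u := by
    rcases hu.lt_or_eq with h0 | h0
    · exact h0
    · rw [← h0] at hi
      nlinarith
  have hu1' : (1 : ℝ) ≤ u := by exact_mod_cast hu1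
  nlinarith

theorem ceil_bounds (h : Brackets α n p q p') (m : ℤ) :
    0 ≤ n * (-((-(m * p)) / n)) - p * m ∧ n * (-((-(m * p)) / n)) - p * m < n := by
  have h1 := Int.emod_add_mul_ediv (-(m * p)) n
  have h2 := Int.emod_nonneg (-(m * p)) h.n_pos.ne'
  have h3 := Int.emod_lt_of_pos (-(m * p)) h.n_pos
  constructor <;> nlinarith

theorem height_bounds (h : Brackets α n p q p') {r m : ℤ} (hr : 0 ≤ r) (hrn : r ≤ n)
    (hm : -r ≤ m) (hmn : m ≤ n - r) :
    m * α ≤ height n p r m ∧ gap α n p q p' r ≤ m * α - height n p r m + 1 := by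
  have hl := h.lower
  have hu := h.upper
  have h1 := h.lower_add_upper_le
  unfold height
  split_ifs with h0
  -- The exceptional value: `nα` lies just above the integer `p`, so its ceiling is `p + 1`.
  · obtain ⟨rfl, rfl⟩ := h0
    simp only [gap, if_true]
    push_cast
    constructor <;> linarith
  · obtain ⟨ha, hb⟩ := h.ceil_bounds m
    set a := -((-(m * p)) / n)
    obtain ⟨hg1, hg2⟩ := h.gap_bound (by omega : -n ≤ m) hb
    refine ⟨h.le_ceil (by omega) ha, ?_⟩
    by_cases hrq : r < q
    · exact (h.gap_le r).trans (hg2 (by omega))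
    · have : r ≠ 0 := by have := h.q_pos; omega
      simp only [gap, if_neg this, if_neg hrq]
      exact hg1

theorem mul_ediv_eq (h : Brackets α n p q p') : (q * p) / n = p' - 1 := by
  have hn := h.n_pos
  have : q * p = (n - 1) + (p' - 1) * n := by linear_combination -h.det
  rw [this, Int.add_mul_ediv_right _ _ hn.ne', Int.ediv_eq_zero_of_lt (by omega) (by omega)]
  ring

/-- The bound of `height_bounds` is attained at the time shift `m` leading to the neighbouring
endpoint: `n`, `n - q` or `-q`. This makes `gap` the exact length, not just a lower bound. -/
theorem exists_height_eq (h : Brackets α n p q p') {r : ℤ} (hr : 0 ≤ r) (hrn : r ≤ n) :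
    ∃ m, -r ≤ m ∧ m ≤ n - r ∧ gap α n p q p' r = m * α - height n p r m + 1 := by
  have hq := h.q_pos
  have hqn := h.q_lt
  by_cases h0 : r = 0
  · refine ⟨n, by omega, by omega, ?_⟩
    simp [gap, height, h0]
    ring
  by_cases hrq : r < q
  · refine ⟨n - q, by omega, by omega, ?_⟩
    have : -((n - q) * p) = q * p + (-p) * n := by ring
    simp only [gap, height, h0, hrq, if_true, if_false, false_and]
    rw [this, Int.add_mul_ediv_right _ _ h.n_pos.ne', h.mul_ediv_eq]
    push_cast
    ring
  · refine ⟨-q, by omega, by omega, ?_⟩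
    have : -(-q * p) = q * p := by ring
    simp only [gap, height, h0, hrq, if_false, false_and]
    rw [this, h.mul_ediv_eq]
    push_cast
    ring

theorem height_zero (h : Brackets α n p q p') (r : ℤ) : height n p r 0 = 0 := by
  have := h.n_pos
  have h0 : ¬ (r = 0 ∧ (0 : ℤ) = n) := by omega
  simp [height, h0]

variable {F : ℝ → ℤ}

theorem step_eq (h : Brackets α n p q p') (hF : IsStep F) {r : ℤ} (hr : 0 ≤ r) (hrn : r ≤ n)
    {y : ℝ} (hy : F (y + gap α n p q p' r) = F y + 1) {m : ℤ} (hm : -r ≤ m) (hmn : m ≤ n - r) :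
    F (y + m * α) = F y + height n p r m := by
  obtain ⟨h1, h2⟩ := h.height_bounds hr hrn hm hmn
  set a := height n p r m
  apply le_antisymm
  · rw [← hF.add_int]
    exact hF.mono (by linarith)
  · have h3 : F (y + gap α n p q p' r + (a - 1 : ℤ)) ≤ F (y + m * α) :=
      hF.mono (by push_cast; linarith)
    rw [hF.add_int, hy] at h3
    omega

/-- The word of length `n` read at `x` is the one with base point `r` exactly on an interval
of length `gap`. -/
theorem word_eq_iff_step (h : Brackets α n p q p') (hF : IsStep F) {r : ℤ} (hr : 0 ≤ r) (hrn : r ≤ n)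
    (x : ℝ) :
    (∀ j : ℤ, 0 ≤ j → j < n → F (x + (j + 1) * α) - F (x + j * α) =
      height n p r (j + 1 - r) - height n p r (j - r)) ↔
    F (x + r * α + gap α n p q p' r) = F (x + r * α) + 1 := by
  constructor
  · intro hw
    have key : ∀ j : ℕ, (j : ℤ) ≤ n →
        F (x + j * α) - F x = height n p r (j - r) - height n p r (-r) := by
      intro j
      induction j with
      | zero => simp
      | succ j ih =>
        intro hj
        have h1 := hw j (by omega) (by push_cast at hj; omega)
        have h2 := ih (by push_cast at hj; omega)
        push_cast at *
        rw [sub_eq_iff_eq_add] at h1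
        rw [h1]
        linarith
    have key' : ∀ j : ℤ, 0 ≤ j → j ≤ n →
        F (x + j * α) - F x = height n p r (j - r) - height n p r (-r) := by
      intro j hj
      lift j to ℕ using hj
      exact_mod_cast key j
    -- The increment at the extremal `m` alone forces the jump, since `x + rα + gap` is a translate
    -- of `x + (m + r)α` by an integer.
    obtain ⟨m, hm1, hm2, hm3⟩ := h.exists_height_eq hr hrn
    have h1 := key' (m + r) (by omega) (by omega)
    have h2 := key' r hr hrn
    rw [sub_self, h.height_zero] at h2
    rw [add_sub_cancel_right] at h1
    have h3 : x + r * α + gap α n p q p' r =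
        x + ((m + r : ℤ) : ℝ) * α + ((1 - height n p r m : ℤ) : ℝ) := by
      rw [hm3]; push_cast; ring
    rw [h3, hF.add_int]
    omega
  · intro hy j hj0 hjn
    have h1 := h.step_eq hF hr hrn hy (m := j + 1 - r) (by omega) (by omega)
    have h2 := h.step_eq hF hr hrn hy (m := j - r) (by omega) (by omega)
    have e1 : x + r * α + ((j + 1 - r : ℤ) : ℝ) * α = x + (j + 1) * α := by push_cast; ring
    have e2 : x + r * α + ((j - r : ℤ) : ℝ) * α = x + j * α := by push_cast; ring
    rw [e1] at h1
    rw [e2] at h2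
    omega

/-- `⌈t⌉ + ⌈-t⌉ = 1` for nonintegral `t = (r' - r)p/n`, and `p` is prime to `n`. If `r' - r = n`,
the exceptional value `p + 1` supplies the `1`. -/
theorem height_add_height_neg (h : Brackets α n p q p') {r r' : ℤ} (hr : 0 ≤ r) (hrr : r < r')
    (hr' : r' ≤ n) : height n p r (r' - r) + height n p r' (r - r') = 1 := by
  have hn := h.n_pos
  have h1 : ¬ (r' = 0 ∧ r - r' = n) := by omega
  by_cases h0 : r = 0 ∧ r' - r = n
  · obtain ⟨rfl, h2⟩ := h0
    have h3 : r' = n := by omega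
    subst h3
    have h4 : ¬ (r' = 0) := by omega
    simp [height, h4]
  · simp only [height, if_neg h0, if_neg h1]
    have e : -((r - r') * p) = -(-((r' - r) * p)) := by ring
    rw [e]
    obtain ⟨ha, hb⟩ := h.ceil_bounds (r' - r)
    obtain ⟨hc, hd⟩ := h.ceil_bounds (r - r')
    rw [e] at hc hd
    generalize -(-((r' - r) * p) / n) = a at *
    generalize -(- -((r' - r) * p) / n) = b at *
    have hs0 : 0 ≤ n * (a + b) := by nlinarith
    have hs1 : n * (a + b) < n * 2 := by nlinarith
    have hs2 : a + b < 2 := lt_of_mul_lt_mul_left hs1 hn.le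
    have hs3 : 0 ≤ a + b := nonneg_of_mul_nonneg_right hs0 hn
    rcases (by omega : a + b = 0 ∨ a + b = 1) with h5 | h5
    · exfalso
      have hab : b = -a := by omega
      subst hab
      have h6 : n * a = p * (r' - r) := by nlinarith
      have h7 : n * (p' * (r' - r) - q * a) = r' - r := by
        linear_combination (-q) * h6 + (r' - r) * h.det
      have h8 : n ∣ r' - r := ⟨_, h7.symm⟩
      have h9 := Int.le_of_dvd (by omega) h8
      omega
    · exact h5

/-- Going from time `r` to `r'` and back would change `F` by `1`. -/
theorem disjoint (h : Brackets α n p q p') (hF : IsStep F) {r r' : ℤ} (hr : 0 ≤ r) (hrn : r ≤ n)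
    (hr' : 0 ≤ r') (hrn' : r' ≤ n) {x : ℝ}
    (h1 : F (x + r * α + gap α n p q p' r) = F (x + r * α) + 1)
    (h2 : F (x + r' * α + gap α n p q p' r') = F (x + r' * α) + 1) : r = r' := by
  wlog hlt : r < r' generalizing r r'
  · rcases lt_trichotomy r r' with h3 | h3 | h3
    · exact absurd h3 hlt
    · exact h3
    · exact (this hr' hrn' hr hrn h2 h1 h3).symm
  have h3 := h.step_eq hF hr hrn h1 (m := r' - r) (by omega) (by omega)
  have h4 := h.step_eq hF hr' hrn' h2 (m := r - r') (by omega) (by omega)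
  have h5 := h.height_add_height_neg hr hlt hrn'
  have e1 : x + r * α + ((r' - r : ℤ) : ℝ) * α = x + r' * α := by push_cast; ring
  have e2 : x + r' * α + ((r - r' : ℤ) : ℝ) * α = x + r * α := by push_cast; ring
  rw [e1] at h3
  rw [e2] at h4
  omega

/-- If `F` jumped across no gap, one could walk from endpoint to neighbouring endpoint, each step at
least `ε` to the right, with `F` unchanged. After more than `1/ε` steps this contradicts `F (x + 1)
= F x + 1`. -/
theorem cover (h : Brackets α n p q p') (hF : IsStep F) (x : ℝ) :
    ∃ r : ℤ, 0 ≤ r ∧ r ≤ n ∧ F (x + r * α + gap α n p q p' r) = F (x + r * α) + 1 := by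
  by_contra! hno
  have hn := h.n_pos
  have hq := h.q_pos
  have hqn := h.q_lt
  have hl := h.lower
  have hu := h.upper
  set ε := min (n * α - p) (p' - q * α)
  have hε : 0 < ε := lt_min hl hu
  have hε1 : ε ≤ n * α - p := min_le_left _ _
  have hε2 : ε ≤ p' - q * α := min_le_right _ _
  have key : ∀ N : ℕ, ∃ r a : ℤ, 0 ≤ r ∧ r ≤ n ∧ x + N * ε ≤ x + r * α + a ∧
      F (x + r * α + a) = F x := by
    intro N
    induction N with
    | zero => exact ⟨0, 0, le_rfl, hn.le, by simp, by simp⟩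
    | succ N ih =>
      obtain ⟨r, a, hr, hrn, hx, hFx⟩ := ih
      have h1 : F (x + r * α + gap α n p q p' r) = F (x + r * α) := by
        have h2 := hF.mono (show x + r * α ≤ x + r * α + gap α n p q p' r by
          linarith [h.gap_pos r])
        have h3 := hF.le_add_one (show x + r * α + gap α n p q p' r ≤ x + r * α + 1 by
          linarith [h.gap_le_one r])
        have h4 := hno r hr hrn
        omega
      have h5 : F (x + r * α + gap α n p q p' r + a) = F x := by
        rw [hF.add_int, h1, ← hF.add_int, hFx]
      by_cases h0 : r = 0
      · have hg : gap α n p q p' r = n * α - p := by simp [gap, h0]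
        have e : x + r * α + gap α n p q p' r + a = x + (n : ℤ) * α + ((a - p : ℤ) : ℝ) := by
          rw [hg, h0]; push_cast; ring
        refine ⟨n, a - p, hn.le, le_rfl, ?_, e ▸ h5⟩
        rw [← e, hg]; push_cast; linarith
      by_cases hrq : r < q
      · have hg : gap α n p q p' r = (n - q) * α - (p - p') := by simp [gap, h0, hrq]
        have e : x + r * α + gap α n p q p' r + a =
            x + ((r + n - q : ℤ) : ℝ) * α + ((a - (p - p') : ℤ) : ℝ) := by
          rw [hg]; push_cast; ring
        refine ⟨r + n - q, a - (p - p'), by omega, by omega, ?_, e ▸ h5⟩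
        rw [← e, hg]; push_cast; linarith
      · have hg : gap α n p q p' r = p' - q * α := by simp [gap, h0, hrq]
        have e : x + r * α + gap α n p q p' r + a =
            x + ((r - q : ℤ) : ℝ) * α + ((a + p' : ℤ) : ℝ) := by
          rw [hg]; push_cast; ring
        refine ⟨r - q, a + p', by omega, by omega, ?_, e ▸ h5⟩
        rw [← e, hg]; push_cast; linarith
  obtain ⟨N, hN⟩ := exists_nat_gt (1 / ε)
  obtain ⟨r, a, -, -, h1, h2⟩ := key N
  rw [div_lt_iff₀ hε] at hN
  have h3 : F (x + 1) ≤ F (x + r * α + a) := hF.mono (by linarith)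
  rw [h2, hF.add_one] at h3
  omega

end Brackets
end Sturmian
namespace Sturmian

/-! ### Lengths of jump sets, density of orbits, and the partition into cells -/

namespace IsStep

variable {F : ℝ → ℤ}

theorem mono_real (hF : IsStep F) : Monotone (fun x => (F x : ℝ)) :=
  fun _ _ h => Int.cast_le.2 (hF.mono h)

theorem intervalIntegrable_add (hF : IsStep F) (c : ℝ) :
    IntervalIntegrable (fun x => (F (x + c) : ℝ)) MeasureTheory.volume 0 1 :=
  Monotone.intervalIntegrable fun _ _ h => hF.mono_real (by linarith)

/-- `x - F x` has period `1`, so its integral over a period is translation invariant. The measure of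
a jump set is then a difference of two such integrals. -/
theorem integral_add (hF : IsStep F) (c : ℝ) :
    ∫ x in (0 : ℝ)..1, (F (x + c) : ℝ) = (∫ x in (0 : ℝ)..1, (F x : ℝ)) + c := by
  have hi : ∀ a b, IntervalIntegrable (fun x => (F x : ℝ)) MeasureTheory.volume a b :=
    fun a b => hF.mono_real.intervalIntegrable
  have hid : ∀ a b : ℝ, IntervalIntegrable (fun x : ℝ => x) MeasureTheory.volume a b :=
    fun a b => continuous_id.intervalIntegrable a b
  have hper : Function.Periodic (fun x => x - (F x : ℝ)) 1 := by
    intro x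
    simp only [hF.add_one]
    push_cast
    ring
  have h1 := hper.intervalIntegral_add_eq c 0
  rw [intervalIntegral.integral_sub (hid _ _) (hi _ _),
    intervalIntegral.integral_sub (hid _ _) (hi _ _), integral_id, integral_id] at h1
  rw [intervalIntegral.integral_comp_add_right (fun x => (F x : ℝ)), zero_add, add_comm 1 c]
  norm_num at h1 ⊢
  linarith

theorem volume_jump (hF : IsStep F) {L : ℝ} (hL : 0 ≤ L) (hL1 : L ≤ 1) (b : ℝ) :
    (MeasureTheory.volume {x | x ∈ Set.Ico (0 : ℝ) 1 ∧ F (x + b + L) = F (x + b) + 1}).toReal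
      = L := by
  set S := {x : ℝ | F (x + b + L) = F (x + b) + 1}
  have hmeas : ∀ c, Measurable fun x => F (x + c) :=
    fun c => hF.mono.measurable.comp (measurable_add_const c)
  have hS : MeasurableSet S := by
    have h1 : Measurable fun x => F (x + b + L) := by
      simpa only [add_assoc] using hmeas (b + L)
    exact measurableSet_eq_fun h1 ((hmeas b).add_const 1)
  have h2 : ∀ x, S.indicator (fun _ => (1 : ℝ)) x = (F (x + (b + L)) : ℝ) - F (x + b) := by
    intro x
    have h3 := hF.mono (show x + b ≤ x + b + L by linarith)
    have h4 := hF.le_add_one (show x + b + L ≤ x + b + 1 by linarith)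
    rw [← add_assoc]
    by_cases hx : x ∈ S
    · rw [Set.indicator_of_mem hx, show F (x + b + L) = F (x + b) + 1 from hx]
      push_cast
      ring
    · rw [Set.indicator_of_notMem hx]
      have h5 : F (x + b + L) ≠ F (x + b) + 1 := hx
      rw [show F (x + b + L) = F (x + b) by omega, sub_self]
  have h3 : ∫ x in (0 : ℝ)..1, S.indicator (fun _ => (1 : ℝ)) x = L := by
    simp only [h2]
    rw [intervalIntegral.integral_sub (hF.intervalIntegrable_add _) (hF.intervalIntegrable_add _),
      hF.integral_add, hF.integral_add]
    ring
  rw [intervalIntegral.integral_of_le zero_le_one, MeasureTheory.integral_indicator hS,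
    MeasureTheory.setIntegral_const, smul_eq_mul, mul_one, MeasureTheory.measureReal_def,
    MeasureTheory.Measure.restrict_apply hS, Set.inter_comm] at h3
  have h4 : MeasureTheory.volume (Set.Ico (0 : ℝ) 1 ∩ S) =
      MeasureTheory.volume (Set.Ioc (0 : ℝ) 1 ∩ S) :=
    MeasureTheory.measure_congr
      (MeasureTheory.Ico_ae_eq_Ioc.inter (MeasureTheory.ae_eq_refl S))
  exact (congrArg ENNReal.toReal h4).trans h3

theorem exists_threshold (hF : IsStep F) : ∃ s, (∀ y < s, F y ≤ 0) ∧ ∀ y, s < y → 1 ≤ F y := by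
  have hne : {y | F y ≤ 0}.Nonempty := ⟨0 - (F 0 : ℤ), by
    show F (0 - (F 0 : ℤ)) ≤ 0
    rw [hF.sub_int]; simp⟩
  have hub : ∀ y, 0 < F y → y ∈ upperBounds {y | F y ≤ 0} := by
    intro y hy z hz
    by_contra hlt
    have h1 := hF.mono (not_le.1 hlt).le
    have h2 : F z ≤ 0 := hz
    omega
  have hbdd : BddAbove {y | F y ≤ 0} := ⟨0 + ((1 - F 0 : ℤ) : ℝ), hub _ (by
    rw [hF.add_int]; omega)⟩
  refine ⟨sSup {y | F y ≤ 0}, fun y hy => ?_, fun y hy => ?_⟩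
  · obtain ⟨z, hz, hyz⟩ := exists_lt_of_lt_csSup hne hy
    exact (hF.mono hyz.le).trans hz
  · by_contra hlt
    exact absurd (le_csSup hbdd (show F y ≤ 0 by omega)) (not_le.2 hy)

end IsStep

theorem exists_orbit_mem_Ioo {α : ℝ} (hα : Irrational α) (ρ : ℝ) {u v : ℝ} (huv : u < v) :
    ∃ (N : ℕ) (a : ℤ), ρ + N * α + a ∈ Set.Ioo u v := by
  have h1 : DenseRange (fun m : ℕ => m • (α : AddCircle (1 : ℝ))) := by
    rw [← denseRange_zsmul_iff_nsmul]
    exact AddCircle.denseRange_zsmul_coe_iff.2 (by simpa using hα)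
  have hopen : IsOpen ((fun x : ℝ => (x : AddCircle (1 : ℝ))) '' Set.Ioo (u - ρ) (v - ρ)) :=
    QuotientAddGroup.isOpenMap_coe _ isOpen_Ioo
  obtain ⟨N, y, hy, hyN⟩ := h1.exists_mem_open hopen
    ((Set.nonempty_Ioo.2 (by linarith)).image _)
  have h2 : ((y : ℝ) : AddCircle (1 : ℝ)) = ((N * α : ℝ) : AddCircle (1 : ℝ)) := by
    have h3 : (y : AddCircle (1 : ℝ)) = N • (α : AddCircle (1 : ℝ)) := hyN
    rw [h3, ← AddCircle.coe_nsmul, nsmul_eq_mul]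
  rw [← sub_eq_zero, ← AddCircle.coe_sub, AddCircle.coe_eq_zero_iff] at h2
  obtain ⟨a, ha⟩ := h2
  rw [zsmul_eq_mul, mul_one] at ha
  exact ⟨N, a, by linarith [hy.1], by linarith [hy.2]⟩

/-- The increments of `F` along the `α`-orbit of `x`, for the times `0 ≤ j < n`, are given
by `g`. -/
def Reads (F : ℝ → ℤ) (α : ℝ) (n : ℤ) (x : ℝ) (g : ℤ → ℤ) : Prop :=
  ∀ j : ℤ, 0 ≤ j → j < n → F (x + (j + 1) * α) - F (x + j * α) = g j

/-- The words of length `n` are `g 0, …, g n`, pairwise distinct, and `g r` is read on an interval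
of length `len r`. -/
structure HasCells (F : ℝ → ℤ) (α : ℝ) (n : ℤ) (g : ℤ → ℤ → ℤ) (len : ℤ → ℝ) : Prop where
  len_pos : ∀ r, 0 < len r
  len_le_one : ∀ r, len r ≤ 1
  cell : ∀ r, 0 ≤ r → r ≤ n → ∃ b, ∀ x, Reads F α n x (g r) ↔ F (x + b + len r) = F (x + b) + 1
  cover : ∀ x, ∃ r, 0 ≤ r ∧ r ≤ n ∧ Reads F α n x (g r)
  disjoint : ∀ x r r', 0 ≤ r → r ≤ n → 0 ≤ r' → r' ≤ n → Reads F α n x (g r) →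
    Reads F α n x (g r') → r = r'

theorem Brackets.hasCells {α : ℝ} {n p q p' : ℤ} {F : ℝ → ℤ} (h : Brackets α n p q p')
    (hF : IsStep F) :
    HasCells F α n (fun r j => height n p r (j + 1 - r) - height n p r (j - r))
      (gap α n p q p') where
  len_pos := h.gap_pos
  len_le_one := h.gap_le_one
  cell r hr hrn := ⟨r * α, h.word_eq_iff_step hF hr hrn⟩
  cover x := by
    obtain ⟨r, hr, hrn, hx⟩ := h.cover hF x
    exact ⟨r, hr, hrn, (h.word_eq_iff_step hF hr hrn x).2 hx⟩
  disjoint x r r' hr hrn hr' hrn' h1 h2 :=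
    h.disjoint hF hr hrn hr' hrn' ((h.word_eq_iff_step hF hr hrn x).1 h1)
      ((h.word_eq_iff_step hF hr' hrn' x).1 h2)

namespace HasCells

variable {F : ℝ → ℤ} {α : ℝ} {n : ℤ} {g : ℤ → ℤ → ℤ} {len : ℤ → ℝ}

theorem reads_neg_iff (x : ℝ) (f : ℤ → ℤ) :
    Reads (fun y => -F (-y)) (-α) n (-x) f ↔ Reads F α n x (fun j => -f j) := by
  have key : ∀ j : ℤ, F (-(-x + (j + 1) * -α)) = F (x + (j + 1) * α) ∧
      F (-(-x + j * -α)) = F (x + j * α) :=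
    fun j => ⟨congrArg F (by ring), congrArg F (by ring)⟩
  refine forall_congr' fun j => forall_congr' fun _ => forall_congr' fun _ => ?_
  simp only [(key j).1, (key j).2]
  omega

theorem neg (h : HasCells (fun y => -F (-y)) (-α) n g len) :
    HasCells F α n (fun r j => -g r j) len where
  len_pos := h.len_pos
  len_le_one := h.len_le_one
  cell r hr hrn := by
    obtain ⟨b, hb⟩ := h.cell r hr hrn
    -- Reflection exchanges the two ends of the jump window, hence the shift by `len r`.
    refine ⟨-b - len r, fun x => ?_⟩
    rw [← reads_neg_iff, hb, show -(-x + b + len r) = x + (-b - len r) by ring,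
      show -(-x + b) = x + (-b - len r) + len r by ring]
    omega
  cover x := by
    obtain ⟨r, hr, hrn, hx⟩ := h.cover (-x)
    exact ⟨r, hr, hrn, (reads_neg_iff x _).1 hx⟩
  disjoint x r r' hr hrn hr' hrn' h1 h2 :=
    h.disjoint (-x) r r' hr hrn hr' hrn' ((reads_neg_iff x _).2 h1) ((reads_neg_iff x _).2 h2)

theorem volume_cell (h : HasCells F α n g len) (hF : IsStep F) {r : ℤ} (hr : 0 ≤ r)
    (hrn : r ≤ n) :
    (MeasureTheory.volume {x | x ∈ Set.Ico (0 : ℝ) 1 ∧ Reads F α n x (g r)}).toReal = len r := by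
  obtain ⟨b, hb⟩ := h.cell r hr hrn
  simp only [hb]
  exact hF.volume_jump (h.len_pos r).le (h.len_le_one r) b

/-- A dense orbit enters the open window of length `len r` before the threshold of `F`; staying off
its ends makes the endpoint convention irrelevant. -/
theorem exists_orbit (h : HasCells F α n g len) (hF : IsStep F) (hα : Irrational α) (ρ : ℝ)
    {r : ℤ} (hr : 0 ≤ r) (hrn : r ≤ n) : ∃ N : ℕ, Reads F α n (ρ + N * α) (g r) := by
  obtain ⟨b, hb⟩ := h.cell r hr hrn
  obtain ⟨s, hs1, hs2⟩ := hF.exists_threshold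
  obtain ⟨N, a, hN⟩ := exists_orbit_mem_Ioo hα (ρ + b) (sub_lt_self s (h.len_pos r))
  refine ⟨N, (hb _).2 ?_⟩
  have h1 : F (ρ + N * α + b + a) ≤ 0 := hs1 _ (by linarith [hN.2])
  have h2 : 1 ≤ F (ρ + N * α + b + len r + a) := hs2 _ (by linarith [hN.1])
  have h3 := hF.le_add_one (show ρ + N * α + b + len r ≤ ρ + N * α + b + 1 by
    linarith [h.len_le_one r])
  rw [hF.add_int] at h1 h2
  omega

end HasCells
end Sturmian
namespace Sturmian

/-! ### Convergents -/

/-- The fractional parts of the complete quotients of `α`. -/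
noncomputable def gaussFract (α : ℝ) : ℕ → ℝ
  | 0 => Int.fract α
  | k + 1 => Int.fract (gaussFract α k)⁻¹

theorem gaussFract_inv_fract (α : ℝ) (k : ℕ) :
    gaussFract (Int.fract α)⁻¹ k = gaussFract α (k + 1) := by
  induction k with
  | zero => rfl
  | succ k ih => exact congrArg (fun x => Int.fract x⁻¹) ih

theorem irrational_fract {α : ℝ} (hα : Irrational α) : Irrational (Int.fract α) :=
  hα.sub_intCast _

theorem irrational_gaussFract {α : ℝ} (hα : Irrational α) (k : ℕ) :
    Irrational (gaussFract α k) := by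
  induction k with
  | zero => exact irrational_fract hα
  | succ k ih => exact irrational_fract ih.inv

theorem gaussFract_pos {α : ℝ} (hα : Irrational α) (k : ℕ) : 0 < gaussFract α k := by
  have h0 : 0 ≤ gaussFract α k := by
    cases k <;> exact Int.fract_nonneg _
  exact h0.lt_of_ne (irrational_gaussFract hα k).ne_zero.symm

theorem gaussFract_lt_one (α : ℝ) (k : ℕ) : gaussFract α k < 1 := by
  cases k <;> exact Int.fract_lt_one _

theorem of_s_get? {α : ℝ} (hα : Irrational α) (k : ℕ) :
    (GenContFract.of α).s.get? k = some ⟨1, (⌊(gaussFract α k)⁻¹⌋ : ℤ)⟩ := by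
  induction k generalizing α with
  | zero => exact GenContFract.of_s_head (irrational_fract hα).ne_zero
  | succ k ih =>
    rw [GenContFract.of_s_succ, ih (irrational_fract hα).inv, gaussFract_inv_fract]

theorem partialQuotient_succ {α : ℝ} (hα : Irrational α) (k : ℕ) :
    (partialQuotient α (k + 1) : ℤ) = ⌊(gaussFract α k)⁻¹⌋ := by
  have h1 := partDens_get?_eq hα k
  rw [GenContFract.partDen_eq_s_b (of_s_get? hα k)] at h1
  have h2 : ((⌊(gaussFract α k)⁻¹⌋ : ℤ) : ℝ) = partialQuotient α (k + 1) := Option.some.inj h1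
  exact_mod_cast h2.symm

theorem partialQuotient_succ_pos {α : ℝ} (hα : Irrational α) (k : ℕ) :
    0 < partialQuotient α (k + 1) := by
  have h1 : (1 : ℤ) ≤ ⌊(gaussFract α k)⁻¹⌋ := by
    rw [Int.le_floor, Int.cast_one]
    exact (one_le_inv₀ (gaussFract_pos hα k)).2 (gaussFract_lt_one α k).le
  have h2 := partialQuotient_succ hα k
  omega

theorem gaussFract_succ_mul {α : ℝ} (hα : Irrational α) (k : ℕ) :
    gaussFract α (k + 1) * gaussFract α k =
      1 - partialQuotient α (k + 1) * gaussFract α k := by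
  have h1 : ((partialQuotient α (k + 1) : ℤ) : ℝ) = ⌊(gaussFract α k)⁻¹⌋ := by
    rw [partialQuotient_succ hα k]
  rw [Int.cast_natCast] at h1
  rw [gaussFract, Int.fract, h1, sub_mul, inv_mul_cancel₀ (gaussFract_pos hα k).ne']

/-- The numerators of the convergents of `α ∈ (0, 1)`. -/
noncomputable def convNum (α : ℝ) : ℕ → ℕ
  | 0 => 0
  | 1 => 1
  | k + 2 => partialQuotient α (k + 2) * convNum α (k + 1) + convNum α k

/-- The distance `|q_k α - p_k|`. -/
noncomputable def convErr (α : ℝ) (k : ℕ) : ℝ :=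
  (-1) ^ k * (convDen α k * α - convNum α k)

theorem convErr_succ_succ (α : ℝ) (k : ℕ) :
    convErr α (k + 2) = convErr α k - partialQuotient α (k + 2) * convErr α (k + 1) := by
  simp only [convErr, convDen, convNum]
  push_cast
  ring

/-- Successive errors have ratio a complete quotient's fractional part, which yields positivity and
thus the alternation of the convergents around `α`. -/
theorem convErr_succ {α : ℝ} (hα : Irrational α) (h0 : 0 < α) (h1 : α < 1) (k : ℕ) :
    convErr α (k + 1) = gaussFract α (k + 1) * convErr α k := by
  induction k with
  | zero =>
    have h2 := gaussFract_succ_mul hα 0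
    have h3 : gaussFract α 0 = α := Int.fract_eq_self.2 ⟨h0.le, h1⟩
    rw [h3] at h2
    simp only [convErr, convDen, convNum]
    push_cast
    linear_combination -h2
  | succ k ih =>
    have h2 := gaussFract_succ_mul hα (k + 1)
    rw [convErr_succ_succ, ih]
    linear_combination (-convErr α k) * h2

theorem convErr_pos {α : ℝ} (hα : Irrational α) (h0 : 0 < α) (h1 : α < 1) (k : ℕ) :
    0 < convErr α k := by
  induction k with
  | zero => simpa [convErr, convDen, convNum] using h0
  | succ k ih =>
    rw [convErr_succ hα h0 h1]
    exact mul_pos (gaussFract_pos hα _) ih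

theorem convDen_pos {α : ℝ} (hα : Irrational α) (k : ℕ) : 0 < convDen α k := by
  induction k using Nat.strong_induction_on with
  | _ k ih =>
    match k with
    | 0 => simp [convDen]
    | 1 => exact partialQuotient_succ_pos hα 0
    | k + 2 =>
      have := ih k (by omega)
      simp only [convDen]
      omega

theorem two_le_partialQuotient_one {α : ℝ} (hα : Irrational α) (h0 : 0 < α) (h2 : α < 1 / 2) :
    2 ≤ partialQuotient α 1 := by
  have h3 : gaussFract α 0 = α := Int.fract_eq_self.2 ⟨h0.le, by linarith⟩
  have h1 : (2 : ℤ) ≤ ⌊(gaussFract α 0)⁻¹⌋ := by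
    rw [Int.le_floor, h3, le_inv_comm₀ (by norm_num) h0]
    norm_num at h2 ⊢
    exact h2.le
  have h4 := partialQuotient_succ hα 0
  rw [zero_add] at h4
  omega

theorem two_le_convDen {α : ℝ} (hα : Irrational α) (h0 : 0 < α) (h2 : α < 1 / 2) (k : ℕ) :
    2 ≤ convDen α (k + 1) := by
  induction k with
  | zero => exact two_le_partialQuotient_one hα h0 h2
  | succ k ih =>
    have h1 := Nat.le_mul_of_pos_left (convDen α (k + 1)) (partialQuotient_succ_pos hα (k + 1))
    simp only [convDen]
    exact (ih.trans h1).trans (Nat.le_add_right _ _)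

theorem convNum_det (α : ℝ) (k : ℕ) :
    (-1) ^ k * ((convNum α (k + 1) : ℤ) * convDen α k - convNum α k * convDen α (k + 1)) = 1 := by
  induction k with
  | zero => simp [convNum, convDen]
  | succ k ih =>
    simp only [convNum, convDen]
    push_cast
    linear_combination ih

/-- The numerator belonging to `semiconvDen`. -/
noncomputable def semiconvNum (α : ℝ) (k l : ℕ) : ℕ :=
  l * convNum α (k - 1) + convNum α (k - 2)

theorem semiconvDen_succ (α : ℝ) (k l : ℕ) :
    semiconvDen α k (l + 1) = convDen α (k - 1) + semiconvDen α k l := by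
  simp only [semiconvDen]; ring

/-- Adding multiples of one row leaves the determinant unchanged. The lower error is `convErr α k -
l * convErr α (k + 1)`, at least `convErr α (k + 2) > 0` because `l` does not exceed the partial
quotient. -/
theorem semiconv_brackets {α : ℝ} (hα : Irrational α) (h0 : 0 < α) (h1 : α < 1) (k : ℕ) {l : ℕ}
    (hl : 0 < l) (hla : l ≤ partialQuotient α (k + 2)) :
    Brackets (((-1) ^ k : ℤ) * α) (semiconvDen α (k + 2) l)
      ((-1) ^ k * semiconvNum α (k + 2) l) (convDen α (k + 1))
      ((-1) ^ k * convNum α (k + 1)) where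
  det := by
    have h := convNum_det α k
    simp only [semiconvDen, semiconvNum, Nat.add_succ_sub_one, Nat.add_sub_cancel]
    push_cast
    linear_combination h
  lower := by
    have h2 := convErr_pos hα h0 h1 (k + 2)
    have h3 := convErr_pos hα h0 h1 (k + 1)
    have h4 : (l : ℝ) ≤ partialQuotient α (k + 2) := by exact_mod_cast hla
    have h5 : 0 < convErr α k - l * convErr α (k + 1) := by
      rw [convErr_succ_succ] at h2
      nlinarith
    simp only [semiconvDen, semiconvNum, Nat.add_succ_sub_one, Nat.add_sub_cancel]
    simp only [convErr] at h5
    push_cast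
    convert h5 using 1
    ring
  upper := by
    have h3 := convErr_pos hα h0 h1 (k + 1)
    simp only [convErr] at h3
    push_cast
    convert h3 using 1
    ring
  q_pos := by exact_mod_cast convDen_pos hα (k + 1)
  q_lt := by
    have h2 := convDen_pos hα k
    have h3 := Nat.le_mul_of_pos_left (convDen α (k + 1)) hl
    simp only [semiconvDen, Nat.add_succ_sub_one, Nat.add_sub_cancel]
    push_cast
    norm_cast
    omega

/-! ### Floors of multiples of `α` near a Farey pair, and the change of sign -/

namespace Brackets

variable {α : ℝ} {n p q p' : ℤ}

/-- Adding `qα` lowers the fractional part by `p' - qα`, so no integer may be crossed. A crossing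
would need `v ≥ 0`, hence `u ≥ 1` and `j ≥ n`; `q ≥ 2` gives `j < n`. -/
theorem floor_add_mul (h : Brackets α n p q p') (hq : 2 ≤ q) {j : ℤ} (hj : 0 < j)
    (hjn : j + q ≤ n + 1) : ⌊((j + q : ℤ) : ℝ) * α⌋ = ⌊j * α⌋ + p' := by
  have h1 := Int.floor_le (j * α)
  have h2 := Int.lt_floor_add_one (j * α)
  set a := ⌊j * α⌋
  have hc := h.coord j a
  have hi := h.coord_int j a
  have hn := h.n_pos
  have hl := h.lower
  have hu := h.upper
  set u := p' * j - q * a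
  set v := n * a - p * j
  have hv : v + 1 ≤ 0 := by
    by_contra hv
    have hu1 : 1 ≤ u := by
      by_contra hu1
      by_cases hv0 : v = 0
      · rw [hv0] at hi
        nlinarith
      · have hu' : (u : ℝ) ≤ 0 := by exact_mod_cast (show u ≤ 0 by omega)
        have hv' : (1 : ℝ) ≤ v := by exact_mod_cast (show 1 ≤ v by omega)
        nlinarith
    by_cases hv0 : v = 0
    · rw [hv0] at hi
      nlinarith
    · have hv1 : 1 ≤ v := by omega
      nlinarith
  by_cases hu0 : u < 0
  · nlinarith
  · have hu' : (0 : ℝ) ≤ u := by exact_mod_cast (not_lt.1 hu0)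
    have hv' : (v : ℝ) + 1 ≤ 0 := by exact_mod_cast hv
    rw [Int.floor_eq_iff]
    push_cast
    constructor <;> nlinarith

theorem floor_mul_eq (h : Brackets α n p q p') {m : ℤ} (hm : 0 ≤ m) (hmn : m < n + q) :
    ⌊m * α⌋ = (m * p) / n := by
  have hn := h.n_pos
  have hl := h.lower
  have hu := h.upper
  have h1 := Int.emod_add_mul_ediv (m * p) n
  have h2 := Int.emod_nonneg (m * p) hn.ne'
  have h3 := Int.emod_lt_of_pos (m * p) hn
  set a := (m * p) / n
  have hm' : (0 : ℝ) ≤ m := by exact_mod_cast hm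
  have hn' : (0 : ℝ) < n := by exact_mod_cast hn
  rw [Int.floor_eq_iff]
  constructor
  · have h4 : ((n * a : ℤ) : ℝ) ≤ ((m * p : ℤ) : ℝ) := by exact_mod_cast (by omega)
    push_cast at h4
    have h5 : (n : ℝ) * a ≤ n * (m * α) := by nlinarith
    exact le_of_mul_le_mul_left h5 hn'
  · have hc := h.coord m (a + 1)
    have hi := h.coord_int m (a + 1)
    have hv : 1 ≤ n * (a + 1) - p * m := by nlinarith
    set u := p' * m - q * (a + 1)
    set v := n * (a + 1) - p * m
    have hq := h.q_pos
    have hu0 : u ≤ 0 := by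
      by_contra hu0
      nlinarith
    have hu' : (u : ℝ) ≤ 0 := by exact_mod_cast hu0
    have hv' : (1 : ℝ) ≤ v := by exact_mod_cast hv
    push_cast at hc
    nlinarith

theorem hasCells_of_sign {F : ℝ → ℤ} {ε : ℤ} (hε : ε = 1 ∨ ε = -1)
    (h : Brackets (ε * α) n p q p') (hF : IsStep F) :
    HasCells F α n (fun r j => ε * (height n p r (j + 1 - r) - height n p r (j - r)))
      (gap (ε * α) n p q p') := by
  rcases hε with rfl | rfl
  · simpa using h.hasCells hF
  · have e : ((-1 : ℤ) : ℝ) * α = -α := by push_cast; ring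
    rw [e] at h ⊢
    simpa only [neg_one_mul] using (h.hasCells hF.neg).neg

end Brackets

theorem floor_neg_of_irrational {x : ℝ} (hx : Irrational x) : ⌊-x⌋ = -⌊x⌋ - 1 := by
  have h1 := (Int.floor_le x).lt_of_ne (hx.ne_int _).symm
  have h2 := Int.lt_floor_add_one x
  rw [Int.floor_eq_iff]
  push_cast
  constructor <;> linarith

theorem irrational_int_mul {α : ℝ} (hα : Irrational α) {m : ℤ} (hm : m ≠ 0) :
    Irrational (m * α) := hα.intCast_mul hm

/-- The `-1` in `⌊-x⌋ = -⌊x⌋ - 1` cancels in differences, provided neither multiple is zero. -/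
theorem floor_sub_floor_sign {α : ℝ} (hα : Irrational α) {ε : ℤ} (hε : ε = 1 ∨ ε = -1)
    {i j : ℤ} (hi : i ≠ 0) (hj : j ≠ 0) :
    ⌊(i : ℝ) * α⌋ - ⌊(j : ℝ) * α⌋ = ε * (⌊(i : ℝ) * (ε * α)⌋ - ⌊(j : ℝ) * (ε * α)⌋) := by
  rcases hε with rfl | rfl
  · simp
  · have e : ∀ m : ℤ, (m : ℝ) * (((-1 : ℤ) : ℝ) * α) = -(m * α) := by intro m; push_cast; ring
    rw [e, e, floor_neg_of_irrational (irrational_int_mul hα hi),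
      floor_neg_of_irrational (irrational_int_mul hα hj)]
    ring

/-! ### The standard words -/

/-- The letters of the word `w` are the values of `g` at `0, …, |w| - 1`. -/
def Spells (w : Word) (g : ℤ → ℤ) : Prop :=
  ∀ (j : ℕ) (hj : j < w.length), ((w[j] : Fin 2) : ℤ) = g j

/-- The letters of the characteristic word of slope `α`. -/
noncomputable def charLetter (α : ℝ) (j : ℤ) : ℤ :=
  ⌊((j + 2 : ℤ) : ℝ) * α⌋ - ⌊((j + 1 : ℤ) : ℝ) * α⌋

theorem Spells.append {u v : Word} {g : ℤ → ℤ} (hu : Spells u g)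
    (hv : Spells v fun j => g (j + u.length)) : Spells (u ++ v) g := by
  intro j hj
  by_cases h : j < u.length
  · rw [List.getElem_append_left h]
    exact hu j h
  · rw [List.getElem_append_right (not_lt.1 h)]
    rw [hv (j - u.length) (by rw [List.length_append] at hj; omega)]
    show g (((j - u.length : ℕ) : ℤ) + u.length) = g j
    congr 1
    omega

theorem Spells.congr {w : Word} {g g' : ℤ → ℤ} (h : Spells w g)
    (hg : ∀ j : ℤ, 0 ≤ j → j < w.length → g j = g' j) : Spells w g' :=
  fun j hj => (h j hj).trans (hg j (by omega) (by omega))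

theorem semistandardWord_succ (α : ℝ) (k l : ℕ) :
    semistandardWord α k (l + 1) = standardWord α (k - 1) ++ semistandardWord α k l := by
  simp [semistandardWord, wordPow, List.replicate_succ]

theorem length_standardWord {α : ℝ} (hα : Irrational α) (k : ℕ) :
    (standardWord α k).length = convDen α k := by
  induction k using Nat.strong_induction_on with
  | _ k ih =>
    match k with
    | 0 => simp [standardWord, convDen]
    | 1 =>
      have := partialQuotient_succ_pos hα 0
      rw [zero_add] at this
      simp only [standardWord, wordPow, convDen, List.length_append, List.length_flatten,
        List.map_replicate, List.length_cons, List.length_nil, List.sum_replicate, smul_eq_mul]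
      omega
    | k + 2 =>
      simp [standardWord, wordPow, convDen, ih k (by omega), ih (k + 1) (by omega)]

theorem length_semistandardWord {α : ℝ} (hα : Irrational α) (k l : ℕ) :
    (semistandardWord α k l).length = semiconvDen α k l := by
  simp [semistandardWord, wordPow, semiconvDen, length_standardWord hα]

/-- Peeling off a leading `s_{k-1}` shifts the characteristic word by `q_{k-1}`, which by
`floor_add_mul` does not change the letters in range. -/
theorem spells_semistandardWord {α : ℝ} (hα : Irrational α) (h0 : 0 < α) (h2 : α < 1 / 2) (k : ℕ)
    (hk : Spells (standardWord α k) (charLetter α))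
    (hk1 : Spells (standardWord α (k + 1)) (charLetter α)) {l : ℕ}
    (hl : l ≤ partialQuotient α (k + 2)) :
    Spells (semistandardWord α (k + 2) l) (charLetter α) := by
  induction l with
  | zero => simpa [semistandardWord, wordPow] using hk
  | succ l ih =>
    rw [semistandardWord_succ]
    refine Spells.append hk1 ((ih (by omega)).congr fun j hj0 hj => ?_)
    have hb := semiconv_brackets hα h0 (by linarith) k (Nat.succ_pos l) hl
    have hq := two_le_convDen hα h0 h2 k
    have hq' : (2 : ℤ) ≤ convDen α (k + 1) := by exact_mod_cast hq
    have hε : ((-1) ^ k : ℤ) = 1 ∨ ((-1) ^ k : ℤ) = -1 := neg_one_pow_eq_or ℤ k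
    have hd := semiconvDen_succ α (k + 2) l
    rw [Nat.add_succ_sub_one] at hd
    rw [length_semistandardWord hα] at hj
    have e1 := hb.floor_add_mul hq' (j := j + 2) (by omega) (by rw [hd]; push_cast; omega)
    have e2 := hb.floor_add_mul hq' (j := j + 1) (by omega) (by rw [hd]; push_cast; omega)
    rw [length_standardWord hα, Nat.add_succ_sub_one]
    unfold charLetter
    rw [floor_sub_floor_sign hα hε (by omega) (by omega),
      floor_sub_floor_sign hα hε (by omega) (by omega),
      show j + (convDen α (k + 1) : ℤ) + 2 = j + 2 + convDen α (k + 1) by ring,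
      show j + (convDen α (k + 1) : ℤ) + 1 = j + 1 + convDen α (k + 1) by ring, e1, e2]
    ring

theorem spells_standardWord {α : ℝ} (hα : Irrational α) (h0 : 0 < α) (h2 : α < 1 / 2) (k : ℕ) :
    Spells (standardWord α k) (charLetter α) := by
  induction k using Nat.strong_induction_on with
  | _ k ih =>
    match k with
    | 0 =>
      have e1 : ⌊2 * α⌋ = 0 := by
        rw [Int.floor_eq_iff]; push_cast; constructor <;> linarith
      have e2 : ⌊α⌋ = 0 := by
        rw [Int.floor_eq_iff]; push_cast; constructor <;> linarith
      intro j hj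
      have hj0 : j = 0 := by simpa [standardWord] using hj
      subst hj0
      simp [standardWord, charLetter, e1, e2]
    | 1 =>
      have hE := convErr_pos hα h0 (by linarith) 1
      have ha := two_le_partialQuotient_one hα h0 h2
      have h3 : gaussFract α 0 = α := Int.fract_eq_self.2 ⟨h0.le, by linarith⟩
      have h4 := gaussFract_succ_mul hα 0
      rw [h3, zero_add] at h4
      have h5 := gaussFract_lt_one α 1
      have h6 := gaussFract_pos hα 1
      set a := partialQuotient α 1
      -- The multiples `mα` stay below `1` up to `m = a` and pass it at `a + 1`: `a - 1` zeros, then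
      -- a one.
      have h7 : a * α < 1 := by nlinarith
      have h8 : 1 < (a + 1) * α := by nlinarith
      have ha' : (2 : ℝ) ≤ a := by exact_mod_cast ha
      have hz : ∀ m : ℤ, 0 ≤ m → m ≤ a → ⌊(m : ℝ) * α⌋ = 0 := by
        intro m hm hma
        have hm' : (0 : ℝ) ≤ m := by exact_mod_cast hm
        have hma' : (m : ℝ) ≤ a := by exact_mod_cast hma
        rw [Int.floor_eq_iff]
        push_cast
        constructor <;> nlinarith
      have e : wordPow [0] (a - 1) = List.replicate (a - 1) (0 : Fin 2) := by
        simp [wordPow]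
      show Spells (wordPow [0] (a - 1) ++ [1]) _
      rw [e]
      refine Spells.append ?_ ?_
      · intro j hj
        rw [List.length_replicate] at hj
        rw [List.getElem_replicate, charLetter, hz _ (by omega) (by omega),
          hz _ (by omega) (by omega)]
        simp
      · intro j hj
        have hj0 : j = 0 := by simpa using hj
        subst hj0
        simp only [List.length_replicate, charLetter]
        have e1 : ((0 : ℕ) : ℤ) + ((a - 1 : ℕ) : ℤ) + 2 = (a : ℤ) + 1 := by omega
        have e2 : ⌊(((a : ℤ) + 1 : ℤ) : ℝ) * α⌋ = 1 := by
          rw [Int.floor_eq_iff]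
          push_cast
          constructor <;> nlinarith
        rw [e1, e2, hz _ (by omega) (by omega)]
        simp
    | k + 2 =>
      exact spells_semistandardWord hα h0 h2 k (ih k (by omega)) (ih (k + 1) (by omega)) le_rfl

/-! ### Cyclic shifts -/

theorem length_cyclicShift (w : Word) : (cyclicShift w).length = w.length := by
  cases w <;> simp [cyclicShift]

theorem length_iterate_cyclicShift (w : Word) (i : ℕ) :
    (cyclicShift^[i] w).length = w.length := by
  induction i with
  | zero => rfl
  | succ i ih => rw [Function.iterate_succ_apply', length_cyclicShift, ih]

theorem Spells.cyclicShift {w : Word} {g : ℤ → ℤ} (h : Spells w g)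
    (hg : Function.Periodic g (w.length : ℤ)) : Spells (cyclicShift w) fun j => g (j - 1) := by
  intro j hj
  rw [length_cyclicShift] at hj
  match w, h, hg with
  | [], _, _ => simp at hj
  | a :: w, h, hg =>
    cases j with
    | zero =>
      have h1 := h w.length (by simp)
      have h2 := hg (-1)
      simp only [Sturmian.cyclicShift, List.getElem_cons_zero, List.getLast_eq_getElem,
        List.length_cons, Nat.add_sub_cancel]
      rw [h1]
      simp only [List.length_cons] at h2
      push_cast at h2 ⊢
      rw [← h2]
      congr 1
      ring
    | succ j =>
      have h1 := h j (by omega)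
      simp only [Sturmian.cyclicShift, List.getElem_cons_succ, List.getElem_dropLast]
      rw [h1]
      push_cast
      rw [add_sub_cancel_right]

theorem Spells.iterate_cyclicShift {w : Word} {g : ℤ → ℤ} (h : Spells w g)
    (hg : Function.Periodic g (w.length : ℤ)) (i : ℕ) :
    Spells (Sturmian.cyclicShift^[i] w) fun j => g (j - i) := by
  induction i with
  | zero => simpa using h
  | succ i ih =>
    rw [Function.iterate_succ_apply']
    have h1 := ih.cyclicShift (by
      rw [length_iterate_cyclicShift]
      intro j
      show g (j + w.length - i) = g (j - i)
      rw [← hg (j - i)]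
      congr 1
      ring)
    refine h1.congr fun j _ _ => ?_
    push_cast
    congr 1
    ring

theorem Spells.reverse {w : Word} {g : ℤ → ℤ} (h : Spells w g) :
    Spells w.reverse fun j => g (w.length - 1 - j) := by
  intro j hj
  rw [List.length_reverse] at hj
  rw [List.getElem_reverse, h _ (by omega)]
  congr 1
  omega

/-- `⌊mα⌋ = ⌊mp/n⌋` holds up to `m = n + 1`, so the letters of `s_{k,l}` extend to period `n`.
Reversal turns floors into ceilings based at `r = 1`, and each cyclic shift raises `r` by one; hence
the `i`-th conjugate has `r = i + 1`. -/
theorem spells_conjugate {α : ℝ} (hα : Irrational α) (h0 : 0 < α) (h2 : α < 1 / 2) (k : ℕ)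
    {l : ℕ} (hl : 0 < l) (hla : l ≤ partialQuotient α (k + 2)) (i : ℕ) :
    Spells (cyclicShift^[i] (semistandardWord α (k + 2) l).reverse) fun j =>
      (-1) ^ k * (height (semiconvDen α (k + 2) l) ((-1) ^ k * semiconvNum α (k + 2) l) (i + 1)
          (j + 1 - (i + 1)) -
        height (semiconvDen α (k + 2) l) ((-1) ^ k * semiconvNum α (k + 2) l) (i + 1)
          (j - (i + 1))) := by
  have hb := semiconv_brackets hα h0 (by linarith) k hl hla
  have hs := spells_semistandardWord hα h0 h2 k (spells_standardWord hα h0 h2 k)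
    (spells_standardWord hα h0 h2 (k + 1)) hla
  have hlen := length_semistandardWord hα (k + 2) l
  have hq : (2 : ℤ) ≤ convDen α (k + 1) := by exact_mod_cast two_le_convDen hα h0 h2 k
  have hε : ((-1) ^ k : ℤ) = 1 ∨ ((-1) ^ k : ℤ) = -1 := neg_one_pow_eq_or ℤ k
  have hn := hb.n_pos
  generalize ((-1) ^ k : ℤ) * semiconvNum α (k + 2) l = p at *
  generalize ((-1) ^ k : ℤ) = ε at *
  set n := semiconvDen α (k + 2) l
  have hper : ∀ m : ℤ, (m + n) * p / n = m * p / n + p := by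
    intro m
    rw [add_mul, mul_comm (n : ℤ) p, Int.add_mul_ediv_right _ _ hn.ne']
  have h3 : Spells (semistandardWord α (k + 2) l) fun j =>
      ε * ((j + 2) * p / n - (j + 1) * p / n) := by
    refine hs.congr fun j hj0 hj => ?_
    rw [hlen] at hj
    rw [charLetter, floor_sub_floor_sign hα hε (by omega) (by omega),
      hb.floor_mul_eq (by omega) (by omega), hb.floor_mul_eq (by omega) (by omega)]
  have h4 := h3.reverse.congr (g' := fun j => ε * ((1 - j) * p / n - (-j) * p / n))
    fun j _ _ => by
      have e1 := hper (1 - j)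
      have e2 := hper (-j)
      rw [hlen]
      rw [show (n : ℤ) - 1 - j + 2 = 1 - j + n by ring, show (n : ℤ) - 1 - j + 1 = -j + n by ring,
        e1, e2]
      ring
  have h5 := h4.iterate_cyclicShift (by
    intro j
    have e1 := hper (1 - (j + n))
    have e2 := hper (-(j + n))
    rw [show 1 - (j + n) + n = 1 - j by ring] at e1
    rw [show -(j + n) + n = -j by ring] at e2
    simp only [List.length_reverse, hlen]
    rw [e1, e2]
    ring) i
  refine h5.congr fun j _ _ => ?_
  have hi : ¬ ((i : ℤ) + 1 = 0) := by omega
  simp only [height, hi, false_and, if_false]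
  rw [show -((j + 1 - (i + 1)) * p) = -(j - i) * p by ring,
    show -((j - (i + 1)) * p) = (1 - (j - i)) * p by ring]
  ring

end Sturmian
namespace Sturmian

/-! ### The words of a rotation -/

/-- The step function whose increments are the letters of the coding. -/
noncomputable def stepFn : Endpoints → ℝ → ℤ
  | .leftClosed, x => ⌊x⌋
  | .rightClosed, x => ⌈x⌉

theorem isStep_stepFn (c : Endpoints) : IsStep (stepFn c) := by
  cases c
  · exact IsStep.floor
  · exact IsStep.ceil

theorem coding_eq {α : ℝ} (h0 : 0 < α) (h1 : α < 1) (c : Endpoints) (x : ℝ) :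
    ((coding α c x : Fin 2) : ℤ) = stepFn c (x + α) - stepFn c x := by
  have e := Int.floor_add_fract x
  have hf0 := Int.fract_nonneg x
  have hf1 := Int.fract_lt_one x
  cases c
  · simp only [coding, stepFn]
    split_ifs with h
    · have : ⌊x + α⌋ = ⌊x⌋ + 1 := by
        rw [Int.floor_eq_iff]; push_cast; constructor <;> linarith
      rw [this]; simp
    · have : ⌊x + α⌋ = ⌊x⌋ := by
        rw [Int.floor_eq_iff]; constructor <;> linarith
      rw [this]; simp
  · simp only [coding, stepFn]
    by_cases hx : Int.fract x = 0
    · have h2 : ⌈x⌉ = ⌊x⌋ := by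
        rw [Int.ceil_eq_iff]; constructor <;> linarith
      have h3 : ⌈x + α⌉ = ⌊x⌋ + 1 := by
        rw [Int.ceil_eq_iff]; push_cast; constructor <;> linarith
      rw [if_pos (Or.inr hx), h2, h3]; simp
    · have hx' : 0 < Int.fract x := hf0.lt_of_ne (Ne.symm hx)
      have h2 : ⌈x⌉ = ⌊x⌋ + 1 := by
        rw [Int.ceil_eq_iff]; push_cast; constructor <;> linarith
      by_cases h : 1 - α < Int.fract x
      · have h3 : ⌈x + α⌉ = ⌊x⌋ + 2 := by
          rw [Int.ceil_eq_iff]; push_cast; constructor <;> linarith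
        rw [if_pos (Or.inl h), h2, h3]; simp
      · have h3 : ⌈x + α⌉ = ⌊x⌋ + 1 := by
          rw [Int.ceil_eq_iff]; push_cast; constructor <;> linarith
        rw [if_neg (not_or.2 ⟨h, hx⟩), h2, h3]; simp

theorem sturmianWord_eq {α : ℝ} (h0 : 0 < α) (h1 : α < 1) (c : Endpoints) (x : ℝ) (m j : ℕ) :
    ((sturmianWord α c x (m + j) : Fin 2) : ℤ) =
      stepFn c (x + m * α + ((j : ℤ) + 1) * α) - stepFn c (x + m * α + (j : ℤ) * α) := by
  rw [sturmianWord, coding_eq h0 h1]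
  push_cast
  congr 2 <;> ring

theorem Spells.eq {w w' : Word} {g : ℤ → ℤ} (h : Spells w g) (h' : Spells w' g)
    (hl : w.length = w'.length) : w = w' := by
  refine List.ext_getElem hl fun j hj hj' => ?_
  have h1 := (h j hj).trans (h' j hj').symm
  exact Fin.ext (by exact_mod_cast h1)

theorem occursAt_iff_reads {α : ℝ} (h0 : 0 < α) (h1 : α < 1) (c : Endpoints) (x : ℝ) (m : ℕ)
    {w : Word} {g : ℤ → ℤ} (hw : Spells w g) :
    OccursAt w (sturmianWord α c x) m ↔ Reads (stepFn c) α w.length (x + m * α) g := by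
  constructor
  · intro h j hj0 hj
    lift j to ℕ using hj0
    have hj' : j < w.length := by exact_mod_cast hj
    rw [← sturmianWord_eq h0 h1, ← h j hj', hw j hj']
  · intro h j hj
    have h2 := h j (by omega) (by exact_mod_cast hj)
    rw [← sturmianWord_eq h0 h1, ← hw j hj] at h2
    exact Fin.ext (by exact_mod_cast h2.symm)

theorem spells_of_occursAt {α : ℝ} (h0 : 0 < α) (h1 : α < 1) (c : Endpoints) (x : ℝ) (m : ℕ)
    {w : Word} {g : ℤ → ℤ} (hw : OccursAt w (sturmianWord α c x) m)
    (hg : Reads (stepFn c) α w.length (x + m * α) g) : Spells w g := by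
  intro j hj
  rw [hw j hj, sturmianWord_eq h0 h1]
  exact hg j (by omega) (by exact_mod_cast hj)

theorem exists_occursAt (u : ℕ → Fin 2) (m n : ℕ) : ∃ w : Word, w.length = n ∧ OccursAt w u m :=
  ⟨List.ofFn fun j : Fin n => u (m + j), by simp, fun j hj => by simp⟩

theorem HasCells.intervalLength_eq {α : ℝ} (h0 : 0 < α) (h1 : α < 1) {c : Endpoints} {w : Word}
    {n : ℕ} {g : ℤ → ℤ → ℤ} {len : ℤ → ℝ} (h : HasCells (stepFn c) α n g len) (hn : w.length = n)
    {r : ℤ} (hr : 0 ≤ r) (hrn : r ≤ n) (hw : Spells w (g r)) : intervalLength α c w = len r := by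
  subst hn
  rw [← h.volume_cell (isStep_stepFn c) hr hrn, intervalLength, wordInterval]
  simp only [occursAt_iff_reads h0 h1 c _ 0 hw, Nat.cast_zero, zero_mul, add_zero]

theorem circleNorm_eq {ε : ℤ} (hε : ε = 1 ∨ ε = -1) {x y : ℝ} (a : ℤ) (hy : y = ε * (x - a))
    (hy0 : 0 < y) (hy1 : y ≤ 1 / 2) : circleNorm x = y := by
  rcases hε with rfl | rfl
  · have h1 : Int.fract x = y := by
      rw [Int.fract_eq_iff]
      exact ⟨hy0.le, by linarith, a, by rw [hy]; push_cast; ring⟩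
    rw [circleNorm, h1, min_eq_left (by linarith)]
  · have h1 : Int.fract x = 1 - y := by
      rw [Int.fract_eq_iff]
      exact ⟨by linarith, by linarith, a - 1, by rw [hy]; push_cast; ring⟩
    rw [circleNorm, h1, min_eq_right (by linarith)]
    ring

/-- Needed to identify `gap` with a distance to the nearest integer. The bound `q ≥ 2` comes from `α
< 1/2`. -/
theorem Brackets.gap_le_half {α : ℝ} {n p q p' : ℤ} (h : Brackets α n p q p') (hq : 2 ≤ q)
    (r : ℤ) : gap α n p q p' r ≤ 1 / 2 := by
  have h1 := h.sum_eq_one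
  have hq' : (2 : ℝ) ≤ q := by exact_mod_cast hq
  have hn' : (2 : ℝ) ≤ n := by exact_mod_cast hq.trans h.q_lt.le
  nlinarith [h.gap_le r, h.lower, h.upper]

end Sturmian

/-! ### Assembly of the theorem -/

open Sturmian in
theorem mainTheorem3 (α : ℝ) (hα : Irrational α) (hα0 : 0 < α) (hα2 : α < 1 / 2)
    (c : Endpoints) (ρ : ℝ) (k l n : ℕ) (hk : 2 ≤ k) (hl : 0 < l)
    (hla : l ≤ partialQuotient α k) (hn : n = semiconvDen α k l) :
    -- the `n` conjugates of the reversal of `s_{k,l}` are distinct factors of length `n`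
    (∀ i < n, cyclicShift^[i] (semistandardWord α k l).reverse ∈ language (sturmianWord α c ρ) ∧
      (cyclicShift^[i] (semistandardWord α k l).reverse).length = n) ∧
    Set.InjOn (fun i => cyclicShift^[i] (semistandardWord α k l).reverse) (Set.Iio n) ∧
    -- the first `q_{k-1} - 1` conjugates
    (∀ i < convDen α (k - 1) - 1,
      intervalLength α c (cyclicShift^[i] (semistandardWord α k l).reverse) =
        circleNorm (semiconvDen α k (l - 1) * α)) ∧
    -- the other `n + 1 - q_{k-1}` conjugates
    (∀ i, convDen α (k - 1) - 1 ≤ i → i < n →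
      intervalLength α c (cyclicShift^[i] (semistandardWord α k l).reverse) =
        circleNorm (convDen α (k - 1) * α)) ∧
    -- there is exactly one other factor of length `n`
    (∃ v : Word,
      {w | w ∈ language (sturmianWord α c ρ) ∧ w.length = n ∧
        ∀ i < n, w ≠ cyclicShift^[i] (semistandardWord α k l).reverse} = {v} ∧
      intervalLength α c v = circleNorm (semiconvDen α k l * α)) := by
  obtain ⟨k, rfl⟩ := Nat.exists_eq_add_of_le' hk
  obtain ⟨l, rfl⟩ := Nat.exists_eq_add_of_lt hl
  rw [zero_add] at *
  have hα1 : α < 1 := by linarith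
  have hb := semiconv_brackets hα hα0 hα1 k hl hla
  have hspell := spells_conjugate hα hα0 hα2 k hl hla
  have hε : ((-1) ^ k : ℤ) = 1 ∨ ((-1) ^ k : ℤ) = -1 := neg_one_pow_eq_or ℤ k
  have hq : (2 : ℤ) ≤ convDen α (k + 1) := by exact_mod_cast two_le_convDen hα hα0 hα2 k
  have hlen : ∀ i, (cyclicShift^[i] (semistandardWord α (k + 2) (l + 1)).reverse).length = n := by
    intro i
    rw [length_iterate_cyclicShift, List.length_reverse, length_semistandardWord hα, hn]
  have hd : n = convDen α (k + 1) + semiconvDen α (k + 2) l := by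
    rw [hn, semiconvDen_succ, Nat.add_succ_sub_one]
  rw [show k + 2 - 1 = k + 1 from rfl, Nat.add_sub_cancel, ← hn]
  rw [← hn] at hb hspell
  have hF := isStep_stepFn c
  have hcells := hb.hasCells_of_sign hε hF
  have hpos := hb.gap_pos
  have hle := hb.gap_le_half hq
  set W := fun i => cyclicShift^[i] (semistandardWord α (k + 2) (l + 1)).reverse with hW
  generalize hε' : ((-1) ^ k : ℤ) = ε at *
  set g : ℤ → ℤ → ℤ := fun r j =>
    ε * (height n (ε * semiconvNum α (k + 2) (l + 1)) r (j + 1 - r) -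
      height n (ε * semiconvNum α (k + 2) (l + 1)) r (j - r)) with hg
  have hspell' : ∀ i : ℕ, Spells (W i) (g (i + 1)) := hspell
  have hlen' : ∀ i : ℕ, (W i).length = n := hlen
  have hocc : ∀ i < n, ∃ m : ℕ, Reads (stepFn c) α n (ρ + m * α) (g (i + 1)) := fun i hi =>
    hcells.exists_orbit hF hα ρ (by omega) (by omega)
  have hvol : ∀ (w : Word) (r : ℤ), w.length = n → 0 ≤ r → r ≤ n → Spells w (g r) →
      intervalLength α c w = gap (ε * α) n (ε * semiconvNum α (k + 2) (l + 1))
        (convDen α (k + 1)) (ε * convNum α (k + 1)) r :=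
    fun w r hw hr hrn hs => hcells.intervalLength_eq hα0 hα1 hw hr hrn hs
  refine ⟨fun i hi => ⟨?_, hlen i⟩, ?_, ?_, ?_, ?_⟩
  · obtain ⟨m, hm⟩ := hocc i hi
    exact ⟨m, (occursAt_iff_reads hα0 hα1 c ρ m (hspell' i)).2 (by rw [hlen']; exact hm)⟩
  · intro i hi i' hi' heq
    obtain ⟨m, hm⟩ := hocc i hi
    have h1 := (occursAt_iff_reads hα0 hα1 c ρ m (hspell' i)).2 (by rw [hlen']; exact hm)
    rw [show W i = W i' from heq, occursAt_iff_reads hα0 hα1 c ρ m (hspell' i'), hlen'] at h1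
    have hi1 : i < n := hi
    have hi2 : i' < n := hi'
    have := hcells.disjoint _ _ _ (by omega) (by omega) (by omega) (by omega) hm h1
    omega
  · intro i hi
    rw [hvol (W i) (i + 1) (hlen' i) (by omega) (by omega) (hspell' i)]
    symm
    refine circleNorm_eq hε (semiconvNum α (k + 2) (l + 1) - convNum α (k + 1)) ?_
      (hpos _) (hle _)
    have h1 : ¬ ((i : ℤ) + 1 = 0) := by omega
    have h2 : (i : ℤ) + 1 < convDen α (k + 1) := by omega
    -- Here `n - q_{k-1} = q_{k,l-1}`, with `l - 1` now written `l`.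
    rw [gap, if_neg h1, if_pos h2, hd]
    push_cast
    ring
  · intro i hi hin
    rw [hvol (W i) (i + 1) (hlen' i) (by omega) (by omega) (hspell' i)]
    symm
    -- The fraction with denominator `q_{k-1}` lies on the other side of `α`, hence the opposite
    -- sign.
    refine circleNorm_eq (ε := -ε) (by omega) (convNum α (k + 1)) ?_ (hpos _) (hle _)
    have h1 : ¬ ((i : ℤ) + 1 = 0) := by omega
    have h2 : ¬ ((i : ℤ) + 1 < convDen α (k + 1)) := by omega
    rw [gap, if_neg h1, if_neg h2]
    push_cast
    ring
  -- The extra factor is the word of the cell `r = 0`.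
  · obtain ⟨m, hm⟩ := hcells.exists_orbit hF hα ρ le_rfl (by omega)
    obtain ⟨v, hv, hvm⟩ := exists_occursAt (sturmianWord α c ρ) m n
    have hvs := spells_of_occursAt hα0 hα1 c ρ m hvm (by rw [hv]; exact hm)
    refine ⟨v, ?_, ?_⟩
    · ext w
      constructor
      · rintro ⟨⟨m', hm'⟩, hw, hne⟩
        obtain ⟨r, hr, hrn, hx⟩ := hcells.cover (ρ + m' * α)
        have hws := spells_of_occursAt hα0 hα1 c ρ m' hm' (by rw [hw]; exact hx)
        rcases hr.eq_or_lt with h0 | h0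
        · subst h0
          exact hws.eq hvs (hw.trans hv.symm)
        · lift r to ℕ using hr
          obtain ⟨i, rfl⟩ := Nat.exists_eq_add_of_lt (show 0 < r by omega)
          rw [zero_add] at *
          refine absurd (hws.eq (w' := W i) ?_ (hw.trans (hlen' i).symm)) (hne i (by omega))
          have h2 := hspell' i
          push_cast
          exact h2
      · rintro rfl
        refine ⟨⟨m, hvm⟩, hv, fun i hi heq => ?_⟩
        have h1 : w = W i := heq
        rw [h1, occursAt_iff_reads hα0 hα1 c ρ m (hspell' i), hlen'] at hvm
        have := hcells.disjoint _ _ _ le_rfl (by omega) (by omega) (by omega) hm hvm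
        omega
    · rw [hvol v 0 hv le_rfl (by omega) hvs]
      symm
      refine circleNorm_eq hε (semiconvNum α (k + 2) (l + 1)) ?_ (hpos _) (hle _)
      rw [gap, if_pos rfl]
      push_cast
      ring
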